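/- Let $A$ be a finite alphabet. A string $Z$ over $A$ is a fractional power of exponent $r$ if $Z=X\cdots XY$, where $X$ is a nonempty string occurring at least once, $Y$ is a (possibly empty) prefix of $X$, and $r=|Z|/|X|$; thus $r$ is a rational number and $r\ge 1$. Theorem. For all real numbers $\alpha,\beta$ with $1<\alpha<\beta$ there exist a finite alphabet $A$ and an infinite sequence $\omega=\omega_0\omega_1\omega_2\ldots$ over $A$ such that (a) for every rational number $r$ with $1\le r<\alpha$, some (contiguous) substring of $\omega$ is a fractional power of exponent $r$; and (b) there exists $\varepsilon>0$ such that for every $n\ge 0$, every substring $u$ of $\omega$ of length $n$, and every string $v$ over $A$ of length $n$ that is a fractional power of some exponent $s\ge\beta$, the Hamming distance between $u$ and $v$ is at least $\varepsilon n$. -/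

import Mathlib

/-- The string `Z` is a fractional power of exponent `r`: it has the form `X ⋯ X Y`, where the
nonempty string `X` occurs `k ≥ 1` times, `Y` is a (possibly empty) prefix of `X`, and
`r = |Z| / |X|`. -/
def IsFractionalPower {A : Type*} (Z : List A) (r : ℚ) : Prop :=
  ∃ (X Y : List A) (k : ℕ), X ≠ [] ∧ 1 ≤ k ∧ Y <+: X ∧
    Z = (List.replicate k X).flatten ++ Y ∧ r = (Z.length : ℚ) / (X.length : ℚ)

/-- The substring `ω i, ω (i + 1), …, ω (i + n - 1)` of length `n` of the infinite sequence `ω`,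
as a word indexed by `Fin n`. -/
def substring {A : Type*} (ω : ℕ → A) (i n : ℕ) : Fin n → A :=
  fun j => ω (i + j)

/-! The sequence is a highly aperiodic background `x` in which exact powers of every rational
exponent in `[1, α)` are planted, very far apart.

The background differs from its shift by any `p` at half or more of the positions of every interval
of length at least `p / D`. Over an alphabet of `(16 * D) ^ 2` letters, `card_spreadWords_growth`
shows by counting that finite words of this kind multiply at each added letter, and
`exists_forall_isSpread` passes to an infinite sequence by compactness.

A patch overwrites `[s, s + t)` by the repetition of a factor of length `q`, with `t / q < α`.
Locally it only translates pieces of `x`, so a patched sequence compared with its shift by `p` is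
still a comparison of `x` with its own shifts, except where both positions copy the same letter. By
`IsEverywhereSpread.mismatches_patch` this needs `q ≤ p` and accounts for at most `t - p ≤ (α - 1) *
p` positions. A power of exponent at least `β` and period `p` makes at least `(β - 1) * p`
comparisons, so a positive proportion of mismatches remains. Sparseness of the patches
(`IsEverywhereSpread.le_mismatches_multiPatch`) lets a window be treated as if it met one patch
only. Finally, changing one letter repairs at most two mismatches, which turns mismatches into
Hamming distance. -/

/-- The number of positions `i` in `[a, a + L)` at which `w` differs from its shift by `p`. -/
def mismatches {A : Type*} [DecidableEq A] (w : ℕ → A) (p a L : ℕ) : ℕ :=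
  ((Finset.Ico a (a + L)).filter fun i => w i ≠ w (i + p)).card

/-- Within its first `n` letters, `w` differs from its shift by `p` at half of the positions, at
least, of every interval of length at least `p / D`. -/
def IsSpread {A : Type*} [DecidableEq A] (D : ℕ) (w : ℕ → A) (n : ℕ) : Prop :=
  ∀ p L a, 1 ≤ p → p ≤ D * L → a + L + p ≤ n → L ≤ 2 * mismatches w p a L

theorem mismatches_congr {A : Type*} [DecidableEq A] {w w' : ℕ → A} {p a L : ℕ}
    (h : ∀ i, i < a + L + p → w i = w' i) : mismatches w p a L = mismatches w' p a L := by
  unfold mismatches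
  congr 1
  apply Finset.filter_congr
  intro i hi
  rw [Finset.mem_Ico] at hi
  rw [h i (by omega), h (i + p) (by omega)]

theorem IsSpread.congr {A : Type*} [DecidableEq A] {D : ℕ} {w w' : ℕ → A} {n : ℕ}
    (hw : IsSpread D w n) (h : ∀ i, i < n → w i = w' i) : IsSpread D w' n := by
  intro p L a hp hL ha
  rw [← mismatches_congr (w := w) fun i hi => h i (by omega)]
  exact hw p L a hp hL ha

theorem IsSpread.mono {A : Type*} [DecidableEq A] {D : ℕ} {w : ℕ → A} {n k : ℕ}
    (hw : IsSpread D w n) (h : k ≤ n) : IsSpread D w k :=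
  fun p L a hp hL ha => hw p L a hp hL (by omega)

/-! ### Counting finite spread words. -/

section Counting

open Classical in
/-- The words of length `n`, extended by zero. -/
noncomputable def zeroExtendedWords (A : Type*) [Fintype A] [Zero A] (n : ℕ) : Finset (ℕ → A) :=
  (Finset.univ : Finset (Fin n → A)).image fun v i => if h : i < n then v ⟨i, h⟩ else 0

theorem mem_zeroExtendedWords {A : Type*} [Fintype A] [Zero A] {n : ℕ} {w : ℕ → A} :
    w ∈ zeroExtendedWords A n ↔ ∀ i, n ≤ i → w i = 0 := by
  classical
  simp only [zeroExtendedWords, Finset.mem_image, Finset.mem_univ, true_and]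
  constructor
  · rintro ⟨v, rfl⟩ i hi
    simp [Nat.not_lt.2 hi]
  · intro h
    refine ⟨fun i => w i, ?_⟩
    ext i
    by_cases hi : i < n
    · simp [hi]
    · simp [hi, h i (not_lt.1 hi)]

open Classical in
/-- The spread words of length `n`, extended by zero. -/
noncomputable def spreadWords (A : Type*) [Fintype A] [Zero A] (D n : ℕ) : Finset (ℕ → A) :=
  (zeroExtendedWords A n).filter fun w => IsSpread D w n

theorem mem_spreadWords {A : Type*} [Fintype A] [DecidableEq A] [Zero A] {D n : ℕ} {w : ℕ → A} :
    w ∈ spreadWords A D n ↔ (∀ i, n ≤ i → w i = 0) ∧ IsSpread D w n := by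
  classical
  rw [spreadWords, Finset.mem_filter, mem_zeroExtendedWords]
  convert Iff.rfl

/-- The words of length `L` with at most half of their letters nonzero. -/
def lightWords (A : Type*) [Fintype A] [DecidableEq A] [Zero A] (L : ℕ) : Finset (Fin L → A) :=
  Finset.univ.filter fun e => 2 * (Finset.univ.filter fun j => e j ≠ 0).card ≤ L

/-- There are at most `2 ^ L` supports, and each carries at most `(M ^ 2) ^ (L / 2)` words; a square
alphabet size makes this `M ^ L`. -/
theorem card_lightWords_le {A : Type*} [Fintype A] [DecidableEq A] [Zero A] {M : ℕ} (hM : 1 ≤ M)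
    (hA : Fintype.card A = M ^ 2) (L : ℕ) : (lightWords A L).card ≤ (2 * M) ^ L := by
  have hsub : lightWords A L ⊆
      ((Finset.univ : Finset (Finset (Fin L))).filter fun T => 2 * T.card ≤ L).biUnion fun T =>
        Fintype.piFinset fun j => if j ∈ T then (Finset.univ : Finset A) else {0} := by
    intro e he
    simp only [lightWords, Finset.mem_filter, Finset.mem_univ, true_and] at he
    simp only [Finset.mem_biUnion, Finset.mem_filter, Finset.mem_univ, true_and,
      Fintype.mem_piFinset]
    refine ⟨_, he, fun j => ?_⟩
    by_cases h : e j = 0 <;> simp [h]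
  refine (Finset.card_le_card hsub).trans (Finset.card_biUnion_le.trans ?_)
  calc _ ≤ ∑ T ∈ (Finset.univ : Finset (Finset (Fin L))).filter (fun T => 2 * T.card ≤ L),
        M ^ L := by
        refine Finset.sum_le_sum fun T hT => ?_
        rw [Finset.mem_filter] at hT
        rw [Fintype.card_piFinset]
        have : ∀ j, (if j ∈ T then (Finset.univ : Finset A) else {0}).card
            = if j ∈ T then M ^ 2 else 1 := by
          intro j; split_ifs <;> simp [hA]
        simp only [this]
        rw [Finset.prod_ite_mem, Finset.univ_inter, Finset.prod_const, ← pow_mul]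
        exact Nat.pow_le_pow_right hM hT.2
    _ ≤ 2 ^ L * M ^ L := by
        rw [Finset.sum_const, smul_eq_mul]
        refine Nat.mul_le_mul_right _ ((Finset.card_filter_le _ _).trans ?_)
        simp
    _ = _ := (mul_pow _ _ _).symm

variable {A : Type*} [Fintype A] [DecidableEq A] [AddGroup A]

/-- One-letter extensions of spread words whose last `L` letters mostly repeat those `p` earlier. -/
theorem card_repetitive_extensions_le {M D n p L : ℕ} (hM : 1 ≤ M) (hA : Fintype.card A = M ^ 2)
    (hp : 1 ≤ p) (hL : 1 ≤ L) (hn : L + p ≤ n + 1) (B : Finset (ℕ → A))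
    (hB : ∀ w ∈ B, (∀ i, n + 1 ≤ i → w i = 0) ∧ IsSpread D w n ∧
      2 * mismatches w p (n + 1 - L - p) L < L) :
    B.card ≤ (spreadWords A D (n + 1 - L)).card * (2 * M) ^ L := by
  refine le_trans ?_ (Nat.mul_le_mul_left _ (card_lightWords_le hM hA L))
  rw [← Finset.card_product]
  set k := n + 1 - L with hk
  -- A word is recovered from its first `k` letters and its differences at distance `p`, letter by
  -- letter from the left, so `p < L` does no harm. The prefix is spread because `k ≤ n`, and the
  -- difference word is light.
  refine Finset.card_le_card_of_injOn (fun w => (fun i => if i < k then w i else 0,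
    fun j : Fin L => w (k + j) - w (k + j - p))) ?_ ?_
  · intro w hw
    obtain ⟨h0, h1, h2⟩ := hB w hw
    rw [Finset.mem_coe, Finset.mem_product]
    constructor
    · rw [mem_spreadWords]
      refine ⟨fun i hi => by simp [Nat.not_lt.2 hi], ?_⟩
      exact (h1.mono (show k ≤ n by omega)).congr fun i hi => by simp [hi]
    · simp only [lightWords, Finset.mem_filter, Finset.mem_univ, true_and, ne_eq, sub_eq_zero]
      refine le_trans (Nat.mul_le_mul_left 2 ?_) h2.le
      unfold mismatches
      refine Finset.card_le_card_of_injOn (fun j : Fin L => k + j - p) ?_ ?_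
      · intro j hj
        simp only [Finset.coe_filter, Finset.mem_univ, true_and, Set.mem_ofPred_eq] at hj
        simp only [Finset.coe_filter, Finset.mem_Ico, Set.mem_ofPred_eq]
        have := j.2
        refine ⟨by omega, ?_⟩
        rw [show k + (j : ℕ) - p + p = k + j by omega]
        exact fun h => hj h.symm
      · intro i _ j _ hij
        simp only at hij
        ext
        omega
  · intro w hw w' hw' h
    obtain ⟨h0, -, -⟩ := hB w hw
    obtain ⟨h0', -, -⟩ := hB w' hw'
    simp only [Prod.mk.injEq] at h
    obtain ⟨h1, h2⟩ := h
    ext i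
    induction i using Nat.strong_induction_on with
    | _ i ih =>
      rcases lt_or_ge i k with hi | hi
      · simpa [hi] using congrFun h1 i
      · rcases lt_or_ge i (n + 1) with hi' | hi'
        · have := congrFun h2 ⟨i - k, by omega⟩
          simp only [show k + (i - k) = i by omega] at this
          rw [ih (i - p) (by omega)] at this
          exact sub_left_injective this
        · rw [h0 i hi', h0' i hi']

theorem card_mul_card_spreadWords_le {M D : ℕ} (hM : 1 ≤ M) (hA : Fintype.card A = M ^ 2) (n : ℕ) :
    M ^ 2 * (spreadWords A D n).card ≤ (spreadWords A D (n + 1)).card +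
      ∑ L ∈ Finset.Icc 1 (n + 1),
        (D * L) * ((spreadWords A D (n + 1 - L)).card * (2 * M) ^ L) := by
  classical
  set E : Finset (ℕ → A) := (zeroExtendedWords A (n + 1)).filter fun w => IsSpread D w n with hE
  have hcard : M ^ 2 * (spreadWords A D n).card ≤ E.card := by
    rw [← hA, ← Finset.card_univ, ← Finset.card_product]
    refine Finset.card_le_card_of_injOn (fun c => Function.update c.2 n c.1) ?_ ?_
    · intro c hc
      have hc' := mem_spreadWords.1 (Finset.mem_product.1 (Finset.mem_coe.1 hc)).2
      rw [Finset.mem_coe, hE, Finset.mem_filter, mem_zeroExtendedWords]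
      refine ⟨fun i hi => ?_, hc'.2.congr fun i hi => ?_⟩
      · have : i ≠ n := by omega
        simpa [Function.update_of_ne this] using hc'.1 i (by omega)
      · simp [Function.update_of_ne hi.ne]
    · intro c hc c' hc' h
      have h1 := mem_spreadWords.1 (Finset.mem_product.1 (Finset.mem_coe.1 hc)).2
      have h1' := mem_spreadWords.1 (Finset.mem_product.1 (Finset.mem_coe.1 hc')).2
      simp only at h
      ext i
      · simpa using congrFun h n
      · by_cases hi : i = n
        · rw [hi, h1.1 n le_rfl, h1'.1 n le_rfl]
        · simpa [Function.update_of_ne hi] using congrFun h i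
  set B : ℕ → ℕ → Finset (ℕ → A) := fun L p => E.filter fun w =>
    L + p ≤ n + 1 ∧ 2 * mismatches w p (n + 1 - L - p) L < L with hB
  have hsub : E ⊆ spreadWords A D (n + 1) ∪
      (Finset.Icc 1 (n + 1)).biUnion fun L => (Finset.Icc 1 (D * L)).biUnion fun p => B L p := by
    intro w hw
    have hw' := hw
    rw [hE, Finset.mem_filter, mem_zeroExtendedWords] at hw'
    by_cases hs : IsSpread D w (n + 1)
    · exact Finset.mem_union_left _ (mem_spreadWords.2 ⟨hw'.1, hs⟩)
    · refine Finset.mem_union_right _ ?_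
      unfold IsSpread at hs
      push Not at hs
      obtain ⟨p, L, a, hp, hpL, ha, hlt⟩ := hs
      -- Since the first `n` letters are spread, a violation must use the new letter; hence `L` and
      -- `p` determine `a`.
      have hend : a + L + p = n + 1 := by
        by_contra hne
        exact absurd (hw'.2 p L a hp hpL (by omega)) (by omega)
      have hL : 1 ≤ L := by omega
      simp only [Finset.mem_biUnion, Finset.mem_Icc]
      refine ⟨L, ⟨hL, by omega⟩, p, ⟨hp, hpL⟩, ?_⟩
      rw [hB, Finset.mem_filter, show n + 1 - L - p = a by omega]
      exact ⟨hw, by omega, hlt⟩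
  refine hcard.trans ((Finset.card_le_card hsub).trans ((Finset.card_union_le _ _).trans ?_))
  refine Nat.add_le_add_left (Finset.card_biUnion_le.trans (Finset.sum_le_sum fun L hL => ?_)) _
  refine Finset.card_biUnion_le.trans ?_
  calc _ ≤ ∑ p ∈ Finset.Icc 1 (D * L),
        ((spreadWords A D (n + 1 - L)).card * (2 * M) ^ L) := by
        refine Finset.sum_le_sum fun p hp => ?_
        rw [Finset.mem_Icc] at hp hL
        by_cases hn : L + p ≤ n + 1
        · refine card_repetitive_extensions_le hM hA hp.1 hL.1 hn _ fun w hw => ?_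
          rw [hB, Finset.mem_filter, hE, Finset.mem_filter, mem_zeroExtendedWords] at hw
          exact ⟨hw.1.1, hw.1.2, hw.2.2⟩
        · have : B L p = ∅ := by
            rw [hB]
            exact Finset.filter_eq_empty_iff.2 fun w _ h => hn h.1
          simp [this]
    _ = _ := by simp

/-- Of the `256 * D ^ 2` extensions per word, the bad ones cost at most `64 * D ^ 2` on average: by
induction, going back `j` letters divides the count by at least `(128 * D ^ 2) ^ j`, and the sum
over `L = j + 1` is dominated by a geometric series of ratio `1 / 2`. -/
theorem card_spreadWords_growth {D : ℕ} (hD : 1 ≤ D) (hA : Fintype.card A = (16 * D) ^ 2) (n : ℕ) :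
    (128 * D ^ 2 : ℝ) * (spreadWords A D n).card ≤ (spreadWords A D (n + 1)).card := by
  induction n using Nat.strong_induction_on with
  | _ n ih =>
    set s : ℕ → ℝ := fun k => ((spreadWords A D k).card : ℝ) with hs
    have hD' : (1 : ℝ) ≤ D := by exact_mod_cast hD
    have hdesc : ∀ j, j ≤ n → (128 * D ^ 2 : ℝ) ^ j * s (n - j) ≤ s n := by
      intro j
      induction j with
      | zero => simp
      | succ j ihj =>
        intro hj
        refine le_trans ?_ (ihj (by omega))
        rw [pow_succ, mul_assoc]
        refine mul_le_mul_of_nonneg_left ?_ (by positivity)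
        have := ih (n - (j + 1)) (by omega)
        rwa [show n - (j + 1) + 1 = n - j by omega] at this
    have hmain := card_mul_card_spreadWords_le (A := A) (D := D) (by omega) hA n
    have hmain' : (256 * D ^ 2 : ℝ) * s n ≤ s (n + 1) + ∑ L ∈ Finset.Icc 1 (n + 1),
        (D * L : ℝ) * (s (n + 1 - L) * (32 * D) ^ L) := by
      have : (((16 * D) ^ 2 * (spreadWords A D n).card : ℕ) : ℝ) ≤ _ := Nat.cast_le.2 hmain
      push_cast at this
      convert this using 2
      · ring
      · refine Finset.sum_congr rfl fun L _ => ?_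
        ring
    have hterm : ∀ j, j ≤ n → (D * (j + 1 : ℕ) : ℝ) * (s (n + 1 - (j + 1)) * (32 * D) ^ (j + 1)) ≤
        (32 * D ^ 2 * s n) * (1 / 2) ^ j := by
      intro j hj
      have h1 := hdesc j hj
      have h2 : ((j + 1 : ℕ) : ℝ) ≤ 2 ^ j := by exact_mod_cast Nat.lt_two_pow_self
      have h3 : (1 : ℝ) ≤ (D : ℝ) ^ j := one_le_pow₀ hD'
      have hs0 : 0 ≤ s (n - j) := by simp [hs]
      rw [show n + 1 - (j + 1) = n - j by omega]
      calc (D * (j + 1 : ℕ) : ℝ) * (s (n - j) * (32 * D) ^ (j + 1))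
          ≤ (D * 2 ^ j) * (s (n - j) * (32 * D) ^ (j + 1)) := by gcongr
        _ = (32 * D ^ 2) * ((32 * D * 2) ^ j * s (n - j)) := by
            rw [mul_pow (32 * (D : ℝ)) 2]; ring
        _ ≤ (32 * D ^ 2) * ((32 * D * 2) ^ j * s (n - j) * D ^ j) := by
            refine mul_le_mul_of_nonneg_left ?_ (by positivity)
            exact le_mul_of_one_le_right (by positivity) h3
        _ = (32 * D ^ 2) * (((128 * D ^ 2) ^ j * s (n - j)) * (1 / 2) ^ j) := by
            have : (32 * D * 2 : ℝ) ^ j * D ^ j = (128 * D ^ 2) ^ j * (1 / 2) ^ j := by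
              rw [← mul_pow, ← mul_pow]
              congr 1
              ring
            linear_combination (32 * D ^ 2 * s (n - j)) * this
        _ ≤ (32 * D ^ 2) * (s n * (1 / 2) ^ j) := by gcongr
        _ = _ := by ring
    have hsum : ∑ L ∈ Finset.Icc 1 (n + 1), (D * L : ℝ) * (s (n + 1 - L) * (32 * D) ^ L) ≤
        (32 * D ^ 2 * s n) * 2 := by
      have hshift := Finset.sum_Ico_add' (fun L : ℕ =>
        (D * L : ℝ) * (s (n + 1 - L) * (32 * D) ^ L)) 0 (n + 1) 1
      rw [show Finset.Icc 1 (n + 1) = Finset.Ico (0 + 1) (n + 1 + 1) by ext; simp, ← hshift]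
      calc _ ≤ ∑ j ∈ Finset.range (n + 1), (32 * D ^ 2 * s n) * (1 / 2 : ℝ) ^ j := by
            rw [Finset.range_eq_Ico]
            refine Finset.sum_le_sum fun j hj => hterm j ?_
            rw [Finset.mem_Ico] at hj
            omega
        _ ≤ _ := by
            rw [← Finset.mul_sum]
            refine mul_le_mul_of_nonneg_left (sum_geometric_two_le _) ?_
            simp only [hs]
            positivity
    change _ * s n ≤ s (n + 1)
    have hnonneg : 0 ≤ (D : ℝ) ^ 2 * s n := by simp only [hs]; positivity
    linarith [hmain', hsum]

end Counting

/-! ### From finite spread words to an infinite one. -/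

theorem exists_isSpread {A : Type*} [Fintype A] [DecidableEq A] [AddGroup A] {D : ℕ} (hD : 1 ≤ D)
    (hA : Fintype.card A = (16 * D) ^ 2) (n : ℕ) : ∃ w : ℕ → A, IsSpread D w n := by
  have hpos : 0 < (spreadWords A D n).card := by
    induction n with
    | zero =>
      refine Finset.card_pos.2 ⟨fun _ => 0, mem_spreadWords.2 ⟨fun _ _ => rfl, ?_⟩⟩
      intro p L a hp _ ha
      omega
    | succ n ih =>
      have h := card_spreadWords_growth hD hA n
      have hD' : (0 : ℝ) < D := by exact_mod_cast hD
      have ih' : (0 : ℝ) < (spreadWords A D n).card := by exact_mod_cast ih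
      have : (0 : ℝ) < (spreadWords A D (n + 1)).card := lt_of_lt_of_le (by positivity) h
      exact_mod_cast this
  obtain ⟨w, hw⟩ := Finset.card_pos.1 hpos
  exact ⟨w, (mem_spreadWords.1 hw).2⟩

theorem exists_forall_isSpread {A : Type*} [Fintype A] [DecidableEq A] [AddGroup A] {D : ℕ}
    (hD : 1 ≤ D) (hA : Fintype.card A = (16 * D) ^ 2) :
    ∃ w : ℕ → A, ∀ n, IsSpread D w n := by
  let _ : TopologicalSpace A := ⊥
  have : DiscreteTopology A := ⟨rfl⟩
  have hclosed : ∀ n, IsClosed {w : ℕ → A | IsSpread D w n} := by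
    intro n
    have hcont : Continuous fun (w : ℕ → A) (i : Fin n) => w i := by fun_prop
    -- The condition depends on the first `n` letters only, so it defines a cylinder set.
    have : {w : ℕ → A | IsSpread D w n} = (fun (w : ℕ → A) (i : Fin n) => w i) ⁻¹'
        ((fun (w : ℕ → A) (i : Fin n) => w i) '' {w | IsSpread D w n}) := by
      ext w
      constructor
      · exact fun h => ⟨w, h, rfl⟩
      · rintro ⟨w', h, heq⟩
        exact IsSpread.congr h fun i hi => congrFun heq ⟨i, hi⟩
    rw [this]
    exact (isClosed_discrete _).preimage hcont
  obtain ⟨w, hw⟩ := IsCompact.nonempty_iInter_of_sequence_nonempty_isCompact_isClosed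
    (fun n => {w : ℕ → A | IsSpread D w n}) (fun n w hw => IsSpread.mono hw (Nat.le_succ n))
    (fun n => exists_isSpread hD hA n) (hclosed 0).isCompact hclosed
  exact ⟨w, fun n => Set.mem_iInter.1 hw n⟩

/-! ### A single periodic patch. -/

/-- `x` differs from its shift by `p` at half of the positions, at least, of every interval of
length at least `p / D`. -/
def IsEverywhereSpread {A : Type*} [DecidableEq A] (D : ℕ) (x : ℕ → A) : Prop :=
  ∀ p L a, 1 ≤ p → p ≤ D * L → L ≤ 2 * mismatches x p a L

theorem Finset.eq_Ico_of_ordConnected {S : Finset ℕ} (hS : (S : Set ℕ).OrdConnected) :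
    ∃ u, S = Finset.Ico u (u + S.card) := by
  rcases S.eq_empty_or_nonempty with rfl | hne
  · exact ⟨0, by simp⟩
  · have h : S = Finset.Ico (S.min' hne) (S.max' hne + 1) := by
      ext i
      rw [Finset.mem_Ico]
      constructor
      · exact fun hi => ⟨S.min'_le i hi, Nat.lt_succ_of_le (S.le_max' i hi)⟩
      · exact fun hi => hS.out (S.min'_mem hne) (S.max'_mem hne) ⟨hi.1, Nat.le_of_lt_succ hi.2⟩
    refine ⟨S.min' hne, ?_⟩
    have hle := S.min'_le _ (S.max'_mem hne)
    have hcard : S.card = S.max' hne + 1 - S.min' hne := by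
      conv_lhs => rw [h]
      simp
    rw [hcard, show S.min' hne + (S.max' hne + 1 - S.min' hne) = S.max' hne + 1 by omega]
    exact h

section Patch

variable {A : Type*} [DecidableEq A] {D : ℕ} {x : ℕ → A}

/-- Two translates of an interval, at a nonzero distance of at most `p`, carry many mismatches. -/
theorem IsEverywhereSpread.card_le_of_translates (hx : IsEverywhereSpread D x) {S : Finset ℕ}
    (hS : (S : Set ℕ).OrdConnected) {f g : ℕ → ℕ} {p c₁ c₂ : ℕ} (hf : ∀ i ∈ S, f i + c₁ = i)
    (hg : ∀ i ∈ S, g i + c₂ = i + p) (hne : ∀ i ∈ S, f i ≠ g i) (hle : ∀ i ∈ S, g i ≤ f i + p)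
    (hle' : ∀ i ∈ S, f i ≤ g i + p) :
    D * S.card ≤ 2 * D * (S.filter fun i => x (f i) ≠ x (g i)).card + p := by
  obtain ⟨u, hu⟩ := Finset.eq_Ico_of_ordConnected hS
  set L := S.card with hL
  rcases Nat.eq_zero_or_pos L with h0 | hpos
  · simp [h0]
  have hmem : ∀ i, i ∈ S ↔ u ≤ i ∧ i < u + L := fun i => by rw [hu, Finset.mem_Ico]
  have huS : u ∈ S := (hmem u).2 (by omega)
  have h1 := hf u huS
  have h2 := hg u huS
  have h3 := hne u huS
  have h4 := hle u huS
  have h5 := hle' u huS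
  rcases lt_or_gt_of_ne h3 with hlt | hlt
  · obtain ⟨d, hd⟩ := Nat.exists_eq_add_of_le hlt.le
    -- If the interval is too short for spreadness at distance `d`, then `D * L < d ≤ p` and the
    -- term `p` absorbs it.
    by_cases hdL : d ≤ D * L
    · have key := hx d L (f u) (by omega) hdL
      have : mismatches x d (f u) L ≤ (S.filter fun i => x (f i) ≠ x (g i)).card := by
        unfold mismatches
        refine Finset.card_le_card_of_injOn (fun i => i + c₁) (fun i hi => ?_)
          (fun i _ j _ hij => by simpa using hij)
        simp only [Finset.coe_filter, Finset.mem_Ico, Set.mem_ofPred_eq] at hi ⊢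
        have hiS : i + c₁ ∈ S := (hmem _).2 (by omega)
        have e1 := hf _ hiS
        have e2 := hg _ hiS
        rw [show f (i + c₁) = i by omega, show g (i + c₁) = i + d by omega]
        exact ⟨hiS, hi.2⟩
      nlinarith
    · omega
  · obtain ⟨d, hd⟩ := Nat.exists_eq_add_of_le hlt.le
    by_cases hdL : d ≤ D * L
    · have key := hx d L (g u) (by omega) hdL
      have : mismatches x d (g u) L ≤ (S.filter fun i => x (f i) ≠ x (g i)).card := by
        unfold mismatches
        refine Finset.card_le_card_of_injOn (fun i => i + d + c₁) (fun i hi => ?_)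
          (fun i _ j _ hij => by simpa using hij)
        simp only [Finset.coe_filter, Finset.mem_Ico, Set.mem_ofPred_eq] at hi ⊢
        have hiS : i + d + c₁ ∈ S := (hmem _).2 (by omega)
        have e1 := hf _ hiS
        have e2 := hg _ hiS
        rw [show f (i + d + c₁) = i + d by omega, show g (i + d + c₁) = i by omega]
        exact ⟨hiS, hi.2.symm⟩
      nlinarith
    · omega

/-- The distance by which `patch x s t q` moves back the letter at position `i`. -/
def patchShift (s t q i : ℕ) : ℕ :=
  if s ≤ i ∧ i < s + t then q * ((i - s) / q) else 0

/-- The marker of the position `i` in `patch x s t q`: it tells the two halves of each period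
apart, and the patch from the rest. -/
def patchMarker (s t q i : ℕ) : Fin 3 :=
  if s ≤ i ∧ i < s + t then (if 2 * ((i - s) % q) < q then 1 else 2) else 0

/-- The sequence `x`, overwritten on `[s, s + t)` by the repetition of its factor of length `q` at
`s`, with markers. -/
def patch (x : ℕ → A) (s t q i : ℕ) : A × Fin 3 :=
  (x (i - patchShift s t q i), patchMarker s t q i)

theorem patchShift_le (s t q i : ℕ) : patchShift s t q i ≤ i := by
  unfold patchShift
  split_ifs with h
  · exact (Nat.mul_div_le _ _).trans (Nat.sub_le _ _)
  · exact Nat.zero_le _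

/-- This is the purpose of the markers: after shifting back, the two compared letters of `x` are at
distance at most `p`. Positions in the same half of different periods have residues less than `q /
2` apart, so the shifts differ by less than `p + q / 2`; as their difference is at least `q`, it is
below `2 * p`. -/
theorem add_le_of_patchMarker_eq {s t q p i : ℕ} (hq : 1 ≤ q)
    (h : patchMarker s t q i = patchMarker s t q (i + p)) :
    patchShift s t q i ≤ patchShift s t q (i + p) ∧
      patchShift s t q (i + p) ≤ patchShift s t q i + 2 * p := by
  unfold patchMarker patchShift at *
  by_cases h1 : s ≤ i ∧ i < s + t <;> by_cases h2 : s ≤ i + p ∧ i + p < s + t <;>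
    simp only [h1, h2, if_true, if_false, and_self] at h ⊢
  · have e1 := Nat.div_add_mod (i - s) q
    have e2 := Nat.div_add_mod (i + p - s) q
    have b1 := Nat.mod_lt (i - s) hq
    have b2 := Nat.mod_lt (i + p - s) hq
    have hle : (i - s) / q ≤ (i + p - s) / q := Nat.div_le_div_right (by omega)
    have hmul := Nat.mul_le_mul_left q hle
    refine ⟨hmul, ?_⟩
    rcases hle.eq_or_lt with heq | hlt
    · rw [heq]; omega
    · have hmul' := Nat.mul_le_mul_left q (Nat.succ_le_of_lt hlt)
      rw [Nat.succ_eq_add_one, mul_add, mul_one] at hmul'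
      generalize q * ((i - s) / q) = m1 at *
      generalize q * ((i + p - s) / q) = m2 at *
      split_ifs at h with c1 c2 c2
      · omega
      · exact absurd h (by decide)
      · exact absurd h (by decide)
      · omega
  · split_ifs at h <;> exact absurd h (by decide)
  · split_ifs at h <;> exact absurd h (by decide)
  · simp

/-- The same letter of `x` is compared with itself only inside the patch, where `p` is a difference
of multiples of `q`. -/
theorem of_patchShift_eq {s t q p i : ℕ} (hp : 1 ≤ p)
    (h : patchShift s t q (i + p) = patchShift s t q i + p) :
    s ≤ i ∧ i + p < s + t ∧ q ≤ p := by
  unfold patchShift at h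
  by_cases h1 : s ≤ i ∧ i < s + t <;> by_cases h2 : s ≤ i + p ∧ i + p < s + t <;>
    simp only [h1, h2, if_true, if_false, and_self] at h
  · refine ⟨h1.1, h2.2, Nat.le_of_dvd hp ?_⟩
    exact (Nat.dvd_add_right (Dvd.intro _ rfl)).1 (h ▸ Dvd.intro _ rfl)
  · omega
  · have := Nat.mul_div_le (i + p - s) q
    omega
  · omega

/-- The index of the period of the patch in which `i` lies, if there are at most `N`. -/
def patchBlock (s t q N i : ℕ) : ℕ :=
  if i < s then 0 else if i < s + t then 1 + (i - s) / q else N + 1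

theorem patchBlock_le {s t q N : ℕ} (ht : t ≤ q * N) (i : ℕ) :
    patchBlock s t q N i ≤ N + 1 := by
  unfold patchBlock
  split_ifs with h1 h2
  · omega
  · have : (i - s) / q < N := Nat.div_lt_of_lt_mul (by omega)
    omega
  · omega

theorem patchBlock_mono {s t q N : ℕ} (ht : t ≤ q * N) : Monotone (patchBlock s t q N) := by
  intro i j hij
  by_cases h2 : j < s + t
  · have : (i - s) / q ≤ (j - s) / q := Nat.div_le_div_right (by omega)
    unfold patchBlock
    generalize (i - s) / q = m at *
    generalize (j - s) / q = n at *
    split_ifs <;> omega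
  · refine (patchBlock_le ht i).trans (le_of_eq ?_)
    unfold patchBlock
    rw [if_neg (by omega), if_neg h2]

theorem patchShift_eq_of_patchBlock_eq {s t q N i j : ℕ} (ht : t ≤ q * N)
    (h : patchBlock s t q N i = patchBlock s t q N j) :
    patchShift s t q i = patchShift s t q j := by
  have aux : ∀ k, patchShift s t q k =
      if patchBlock s t q N k = 0 ∨ patchBlock s t q N k = N + 1 then 0
      else q * (patchBlock s t q N k - 1) := by
    intro k
    unfold patchShift patchBlock
    by_cases h1 : k < s
    · simp [h1]
    · by_cases h2 : k < s + t
      · have : (k - s) / q < N := Nat.div_lt_of_lt_mul (by omega)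
        generalize (k - s) / q = m at *
        rw [if_pos ⟨by omega, h2⟩, if_neg h1, if_pos h2, if_neg (by omega), Nat.add_sub_cancel_left]
      · simp [h1, h2]
  rw [aux, aux, h]

/-- A patched spread sequence differs often from its shift by `p`, except where `p` is a multiple
of the period of the patch. -/
theorem IsEverywhereSpread.mismatches_patch (hx : IsEverywhereSpread D x) {s t q N p : ℕ}
    (hq : 1 ≤ q) (hp : 1 ≤ p) (ht : t ≤ q * N) (a L : ℕ) :
    ∃ z, (z = 0 ∨ q ≤ p ∧ z + p ≤ t) ∧
      D * L ≤ 2 * D * mismatches (patch x s t q) p a L + (N + 2) ^ 2 * p + D * z := by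
  set w := patch x s t q with hw
  set sh := patchShift s t q with hsh
  have hshle : ∀ i, sh i ≤ i := patchShift_le s t q
  -- Positions are classified by the blocks of `i` and `i + p`. Each of the at most `(N + 2) ^ 2`
  -- classes is an interval, blocks being monotone, and both shifts are constant on it; each class
  -- contributes an error of at most `p`.
  set b := patchBlock s t q N with hb
  set I := Finset.Ico a (a + L) with hI
  set Z := I.filter fun i => sh (i + p) = sh i + p with hZ
  set K : Finset (ℕ × ℕ) := Finset.range (N + 2) ×ˢ Finset.range (N + 2) with hK
  set key : ℕ → ℕ × ℕ := fun i => (b i, b (i + p)) with hkey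
  have hmaps : ∀ i, key i ∈ K := by
    intro i
    rw [hK, Finset.mem_product, Finset.mem_range, Finset.mem_range]
    exact ⟨Nat.lt_succ_of_le (patchBlock_le ht _), Nat.lt_succ_of_le (patchBlock_le ht _)⟩
  refine ⟨Z.card, ?_, ?_⟩
  · rcases Z.eq_empty_or_nonempty with h0 | ⟨i, hi⟩
    · exact Or.inl (by rw [h0]; rfl)
    · have hall : ∀ i ∈ Z, s ≤ i ∧ i + p < s + t ∧ q ≤ p := fun i hi =>
        of_patchShift_eq hp (Finset.mem_filter.1 hi).2
      refine Or.inr ⟨(hall i hi).2.2, ?_⟩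
      have hsub : Z ⊆ Finset.Ico s (s + t - p) := fun i hi => by
        have := hall i hi
        rw [Finset.mem_Ico]
        omega
      have hc := Finset.card_le_card hsub
      rw [Nat.card_Ico] at hc
      have := hall i hi
      omega
  · have hfib : ∀ κ ∈ K, D * (I.filter fun i => key i = κ).card ≤
        2 * D * ((I.filter fun i => w i ≠ w (i + p)).filter fun i => key i = κ).card + p +
          D * (Z.filter fun i => key i = κ).card := by
      intro κ _
      set S := I.filter fun i => key i = κ with hS
      have hmemS : ∀ i, i ∈ S ↔ (a ≤ i ∧ i < a + L) ∧ b i = κ.1 ∧ b (i + p) = κ.2 := by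
        intro i
        rw [hS, Finset.mem_filter, hI, Finset.mem_Ico, hkey, Prod.ext_iff]
      have hcomm : ((I.filter fun i => w i ≠ w (i + p)).filter fun i => key i = κ) =
          S.filter fun i => w i ≠ w (i + p) := Finset.filter_comm _ _ _
      have hcomm' : (Z.filter fun i => key i = κ) = S.filter fun i => sh (i + p) = sh i + p :=
        Finset.filter_comm _ _ _
      rw [hcomm, hcomm']
      have hconn : (S : Set ℕ).OrdConnected := by
        refine ⟨fun i hi j hj k hk => ?_⟩
        rw [Finset.mem_coe, hmemS] at hi hj ⊢
        have m1 : b i ≤ b k := patchBlock_mono ht hk.1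
        have m2 : b k ≤ b j := patchBlock_mono ht hk.2
        have m3 : b (i + p) ≤ b (k + p) := patchBlock_mono ht (Nat.add_le_add_right hk.1 p)
        have m4 : b (k + p) ≤ b (j + p) := patchBlock_mono ht (Nat.add_le_add_right hk.2 p)
        have := hk.1
        have := hk.2
        omega
      -- If the markers never agree, the whole class consists of mismatches. A single agreement
      -- bounds the distance of the translates throughout the class.
      by_cases hex : ∃ i₀ ∈ S, patchMarker s t q i₀ = patchMarker s t q (i₀ + p)
      · obtain ⟨i₀, hi₀, hmark⟩ := hex
        have hbd : sh i₀ ≤ sh (i₀ + p) ∧ sh (i₀ + p) ≤ sh i₀ + 2 * p :=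
          add_le_of_patchMarker_eq hq hmark
        have hconst : ∀ i ∈ S, sh i = sh i₀ ∧ sh (i + p) = sh (i₀ + p) := by
          intro i hi
          rw [hmemS] at hi hi₀
          exact ⟨patchShift_eq_of_patchBlock_eq ht (hi.2.1.trans hi₀.2.1.symm),
            patchShift_eq_of_patchBlock_eq ht (hi.2.2.trans hi₀.2.2.symm)⟩
        by_cases hzero : sh (i₀ + p) = sh i₀ + p
        · have : (S.filter fun i => sh (i + p) = sh i + p) = S := by
            refine Finset.filter_true_of_mem fun i hi => ?_
            rw [(hconst i hi).1, (hconst i hi).2, hzero]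
          rw [this]
          omega
        · have key := hx.card_le_of_translates hconn (f := fun i => i - sh i)
            (g := fun i => i + p - sh (i + p)) (p := p) (c₁ := sh i₀) (c₂ := sh (i₀ + p))
            (fun i hi => by
              have := hshle i
              have := hconst i hi
              omega)
            (fun i hi => by
              have := hshle (i + p)
              have := hconst i hi
              omega)
            (fun i hi => by
              have := hshle i
              have := hshle (i + p)
              have := hconst i hi
              omega)
            (fun i hi => by
              have := hshle i
              have := hshle (i + p)
              have := hconst i hi
              omega)
            (fun i hi => by
              have := hshle i
              have := hshle (i + p)
              have := hconst i hi
              omega)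
          have hsub : (S.filter fun i => x (i - sh i) ≠ x (i + p - sh (i + p))) ⊆
              S.filter fun i => w i ≠ w (i + p) := by
            refine Finset.monotone_filter_right S fun i _ hne heq => hne ?_
            exact congrArg Prod.fst heq
          have hc := Nat.mul_le_mul_left (2 * D) (Finset.card_le_card hsub)
          omega
      · push Not at hex
        have : (S.filter fun i => w i ≠ w (i + p)) = S := by
          refine Finset.filter_true_of_mem fun i hi heq => hex i hi ?_
          exact congrArg Prod.snd heq
        rw [this]
        nlinarith [Nat.zero_le (D * S.card),
          Nat.zero_le (D * (S.filter fun i => sh (i + p) = sh i + p).card)]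
    have hsum := Finset.sum_le_sum hfib
    rw [Finset.sum_add_distrib, Finset.sum_add_distrib, ← Finset.mul_sum, ← Finset.mul_sum,
      ← Finset.mul_sum, ← Finset.card_eq_sum_card_fiberwise fun i _ => hmaps i,
      ← Finset.card_eq_sum_card_fiberwise fun i _ => hmaps i,
      ← Finset.card_eq_sum_card_fiberwise fun i _ => hmaps i, Finset.sum_const, hK,
      Finset.card_product, Finset.card_range, smul_eq_mul, hI, Nat.card_Ico] at hsum
    rw [pow_two]
    unfold mismatches
    simpa using hsum

end Patch

/-! ### Fractional powers, periods and Hamming distance. -/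

theorem flatten_replicate_map_range {A : Type*} (g : ℕ → A) {q m : ℕ} (hm : m < q) (k : ℕ) :
    (List.range (k * q + m)).map (fun u => g (u % q)) =
      (List.replicate k ((List.range q).map g)).flatten ++ (List.range m).map g := by
  induction k with
  | zero =>
    simp only [Nat.zero_mul, Nat.zero_add, List.replicate_zero, List.flatten_nil, List.nil_append]
    refine List.map_congr_left fun u hu => ?_
    rw [List.mem_range] at hu
    rw [Nat.mod_eq_of_lt (hu.trans hm)]
  | succ k ih =>
    rw [show (k + 1) * q + m = q + (k * q + m) by ring, List.range_add, List.map_append,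
      List.map_map, List.replicate_succ, List.flatten_cons, List.append_assoc, ← ih]
    congr 1
    · refine List.map_congr_left fun u hu => ?_
      rw [List.mem_range] at hu
      rw [Nat.mod_eq_of_lt hu]
    · refine List.map_congr_left fun u _ => ?_
      simp

theorem isFractionalPower_ofFn {A : Type*} {g : ℕ → A} {q n : ℕ} (hq : 1 ≤ q) (hqn : q ≤ n)
    (hg : ∀ u < n, g u = g (u % q)) :
    IsFractionalPower (List.ofFn fun j : Fin n => g j) ((n : ℚ) / q) := by
  refine ⟨(List.range q).map g, (List.range (n % q)).map g, n / q, ?_, Nat.div_pos hqn hq, ?_, ?_,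
    by simp⟩
  · rw [Ne, List.map_eq_nil_iff, List.range_eq_nil]
    omega
  · refine List.IsPrefix.map _ ?_
    have : q = n % q + (q - n % q) := by have := Nat.mod_lt n hq; omega
    conv_rhs => rw [this, List.range_add]
    exact List.prefix_append _ _
  · rw [← flatten_replicate_map_range g (Nat.mod_lt n hq), Nat.div_add_mod']
    refine List.ext_getElem (by simp) fun i h _ => ?_
    simp only [List.getElem_ofFn, List.getElem_map, List.getElem_range]
    exact hg i (by simpa using h)

theorem IsFractionalPower.exists_period {A : Type*} {n : ℕ} {v : Fin n → A} {s : ℚ}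
    (h : IsFractionalPower (List.ofFn v) s) :
    ∃ p : ℕ, 1 ≤ p ∧ (n : ℚ) = s * p ∧
      ∀ i (hi : i + p < n), v ⟨i, by omega⟩ = v ⟨i + p, hi⟩ := by
  obtain ⟨X, Y, k, hX, -, hY, hZ, hs⟩ := h
  have hpos : 0 < X.length := List.length_pos_iff.2 hX
  refine ⟨X.length, hpos, ?_, fun i hi => ?_⟩
  · rw [hs, List.length_ofFn, div_mul_cancel₀]
    exact_mod_cast hpos.ne'
  · have hpre : List.ofFn v <+: X ++ List.ofFn v := by
      have h1 : (List.replicate k X).flatten ++ Y <+: (List.replicate k X).flatten ++ X :=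
        (List.prefix_append_right_inj _).2 hY
      have h2 : (List.replicate k X).flatten ++ X = X ++ (List.replicate k X).flatten := by
        have e := congrArg List.flatten (List.replicate_succ' (n := k) (a := X))
        rw [List.replicate_succ, List.flatten_cons, List.flatten_append] at e
        simpa using e.symm
      rw [hZ, ← List.append_assoc, ← h2]
      exact h1.trans (List.prefix_append _ _)
    have hget := hpre.getElem (i := i + X.length) (by simpa using hi)
    simpa using hget.symm

/-- Since `v` has period `p`, a mismatch at `i` forces an error at `i` or at `i + p`, and each error
is charged at most twice. -/
theorem mismatches_le_two_mul_hammingDist {A : Type*} [DecidableEq A] (ω : ℕ → A) {a n p L : ℕ}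
    (hn : L + p = n) (v : Fin n → A)
    (hv : ∀ i (hi : i + p < n), v ⟨i, by omega⟩ = v ⟨i + p, hi⟩) :
    mismatches ω p a L ≤ 2 * hammingDist (substring ω a n) v := by
  set T := Finset.univ.filter fun j => substring ω a n j ≠ v j with hT
  have hd : hammingDist (substring ω a n) v = T.card := rfl
  have hsub : ((Finset.Ico a (a + L)).filter fun i => ω i ≠ ω (i + p)) ⊆
      (T.image fun j : Fin n => a + (j : ℕ)) ∪ T.image fun j : Fin n => a + (j : ℕ) - p := by
    intro i hi
    rw [Finset.mem_filter, Finset.mem_Ico] at hi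
    obtain ⟨⟨h1, h2⟩, hne⟩ := hi
    rw [Finset.mem_union, Finset.mem_image, Finset.mem_image]
    by_contra hcon
    push Not at hcon
    have e1 : substring ω a n ⟨i - a, by omega⟩ = v ⟨i - a, by omega⟩ := by
      by_contra hc
      exact hcon.1 _ (Finset.mem_filter.2 ⟨Finset.mem_univ _, hc⟩) (by simp only; omega)
    have e2 : substring ω a n ⟨i - a + p, by omega⟩ = v ⟨i - a + p, by omega⟩ := by
      by_contra hc
      exact hcon.2 _ (Finset.mem_filter.2 ⟨Finset.mem_univ _, hc⟩) (by simp only; omega)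
    have e3 := hv (i - a) (by omega)
    rw [← e1, ← e2] at e3
    simp only [substring] at e3
    rw [show a + (i - a) = i by omega, show a + (i - a + p) = i + p by omega] at e3
    exact hne e3
  calc mismatches ω p a L ≤ _ := Finset.card_le_card hsub
    _ ≤ T.card + T.card := (Finset.card_union_le _ _).trans
        (Nat.add_le_add Finset.card_image_le Finset.card_image_le)
    _ = _ := by rw [hd, two_mul]

theorem mismatches_le_add {A : Type*} [DecidableEq A] {w w' : ℕ → A} {p a L E : ℕ}
    (h : ∀ i, a ≤ i → E ≤ i → i < a + L + p → w i = w' i) :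
    mismatches w p a L ≤ mismatches w' p a L + E := by
  have hsub : ((Finset.Ico a (a + L)).filter fun i => w i ≠ w (i + p)) ⊆
      ((Finset.Ico a (a + L)).filter fun i => w' i ≠ w' (i + p)) ∪ Finset.range E := by
    intro i hi
    rw [Finset.mem_filter, Finset.mem_Ico] at hi
    rw [Finset.mem_union, Finset.mem_filter, Finset.mem_Ico, Finset.mem_range]
    by_cases hE : i < E
    · exact Or.inr hE
    · rw [← h i (by omega) (by omega) (by omega), ← h (i + p) (by omega) (by omega) (by omega)]
      exact Or.inl hi
  refine (Finset.card_le_card hsub).trans ((Finset.card_union_le _ _).trans ?_)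
  rw [Finset.card_range]
  rfl

theorem mismatches_comp {A B : Type*} [DecidableEq A] [DecidableEq B] {e : A → B}
    (he : Function.Injective e) (w : ℕ → A) (p a L : ℕ) :
    mismatches (e ∘ w) p a L = mismatches w p a L := by
  unfold mismatches
  congr 1
  exact Finset.filter_congr fun i _ => he.ne_iff

/-! ### Infinitely many sparse patches. -/

section Patches

/-- Starting points for patches of lengths `t 0, t 1, …`, each beyond `C` times the end of the
previous patch. -/
def patchStart (C : ℕ) (t : ℕ → ℕ) : ℕ → ℕ
  | 0 => 0
  | j + 1 => C * (patchStart C t j + t j) + 1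

/-- The end of the patch before the `j`-th. -/
def patchPrevEnd (C : ℕ) (t : ℕ → ℕ) : ℕ → ℕ
  | 0 => 0
  | j + 1 => patchStart C t j + t j

/-- The sequence `x` with patches of lengths `t j` and periods `q j`. -/
def multiPatch {A : Type*} (x : ℕ → A) (C : ℕ) (t q : ℕ → ℕ) (i : ℕ) : A × Fin 3 :=
  let j := Nat.findGreatest (fun j => patchStart C t j ≤ i) i
  patch x (patchStart C t j) (t j) (q j) i

variable {A : Type*} {C : ℕ} {t : ℕ → ℕ}

theorem patchStart_add_lt (hC : 1 ≤ C) (j : ℕ) :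
    patchStart C t j + t j < patchStart C t (j + 1) :=
  Nat.lt_succ_of_le (Nat.le_mul_of_pos_left _ hC)

theorem patchStart_strictMono (hC : 1 ≤ C) : StrictMono (patchStart C t) :=
  strictMono_nat_of_lt_succ fun j => (Nat.le_add_right _ _).trans_lt (patchStart_add_lt hC j)

theorem findGreatest_patchStart_eq (hC : 1 ≤ C) {i j : ℕ} (h : patchStart C t j ≤ i)
    (h' : i < patchStart C t (j + 1)) :
    Nat.findGreatest (fun j => patchStart C t j ≤ i) i = j := by
  rw [Nat.findGreatest_eq_iff]
  refine ⟨((patchStart_strictMono hC).id_le j).trans h, fun _ => h, fun k hk _ hle => ?_⟩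
  exact absurd ((patchStart_strictMono (t := t) hC).monotone (Nat.succ_le_of_lt hk))
    (by rw [Nat.succ_eq_add_one]; omega)

theorem exists_patchStart_le_lt (hC : 1 ≤ C) (i : ℕ) :
    ∃ j, patchStart C t j ≤ i ∧ i < patchStart C t (j + 1) := by
  refine ⟨Nat.findGreatest (fun j => patchStart C t j ≤ i) i, ?_, ?_⟩
  · exact Nat.findGreatest_spec (P := fun j => patchStart C t j ≤ i) (Nat.zero_le i)
      (Nat.zero_le i)
  · by_contra hcon
    rw [not_lt] at hcon
    have := Nat.le_findGreatest (P := fun j => patchStart C t j ≤ i)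
      (((patchStart_strictMono hC).id_le _).trans hcon) hcon
    exact absurd this (Nat.not_succ_le_self _)

/-- The gap before the patch is included: there the previous patch has ended and both sides are
plain `x` with marker `0`. -/
theorem multiPatch_eq_patch (hC : 1 ≤ C) (x : ℕ → A) (q : ℕ → ℕ) {i j : ℕ}
    (h : patchPrevEnd C t j ≤ i) (h' : i < patchStart C t (j + 1)) :
    multiPatch x C t q i = patch x (patchStart C t j) (t j) (q j) i := by
  unfold multiPatch
  rcases lt_or_ge i (patchStart C t j) with hlt | hge
  · cases j with
    | zero => exact absurd hlt (Nat.not_lt_zero _)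
    | succ j =>
      simp only [patchPrevEnd] at h
      simp only [findGreatest_patchStart_eq (t := t) hC ((Nat.le_add_right _ _).trans h) hlt]
      unfold patch patchShift patchMarker
      simp [Nat.not_lt.2 h, Nat.not_le.2 hlt]
  · simp only [findGreatest_patchStart_eq (t := t) hC hge h']

theorem mul_patchPrevEnd_le (C : ℕ) (t : ℕ → ℕ) (j : ℕ) :
    C * patchPrevEnd C t j ≤ patchStart C t j := by
  cases j with
  | zero => simp [patchPrevEnd]
  | succ j => exact Nat.le_succ _

theorem isFractionalPower_multiPatch {B : Type*} (e : A × Fin 3 → B) (hC : 1 ≤ C) (x : ℕ → A)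
    (q : ℕ → ℕ) {j : ℕ} (hq : 1 ≤ q j) (hqt : q j ≤ t j) :
    IsFractionalPower (List.ofFn (substring (e ∘ multiPatch x C t q) (patchStart C t j) (t j)))
      ((t j : ℚ) / q j) := by
  refine isFractionalPower_ofFn
    (g := fun u => (e ∘ multiPatch x C t q) (patchStart C t j + u)) hq hqt fun u hu => ?_
  have hlt := patchStart_add_lt (t := t) hC j
  have hmod : u % q j ≤ u := Nat.mod_le _ _
  have hend : patchPrevEnd C t j ≤ patchStart C t j :=
    (Nat.le_mul_of_pos_left _ hC).trans (mul_patchPrevEnd_le C t j)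
  simp only [Function.comp_apply]
  rw [multiPatch_eq_patch hC x q (j := j) (by omega) (by omega),
    multiPatch_eq_patch hC x q (j := j) (by omega) (by omega)]
  unfold patch patchShift patchMarker
  have hle : q j * (u / q j) ≤ u := Nat.mul_div_le _ _
  have heq : u % q j + q j * (u / q j) = u := Nat.mod_add_div _ _
  have hsmall : u % q j / q j = 0 := Nat.div_eq_of_lt (Nat.mod_lt _ hq)
  simp only [Nat.le_add_right, true_and, Nat.add_lt_add_iff_left, hu, hmod.trans_lt hu, if_true,
    Nat.add_sub_cancel_left, Nat.mod_mod, hsmall, Nat.mul_zero, Nat.sub_zero]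
  congr 3
  omega

/-- Every long window of a spread sequence with sparse patches is far from its shift by `p`. -/
theorem IsEverywhereSpread.le_mismatches_multiPatch [DecidableEq A] {D N : ℕ} {x : ℕ → A}
    (hx : IsEverywhereSpread D x) {α β : ℝ} (hα : 1 < α) (hαβ : α < β) (hαN : α ≤ N)
    (hD : 2 * ((N : ℝ) + 2) ^ 2 ≤ D * (β - α)) (hC : 8 * β ≤ (C - 1) * (β - α)) {q : ℕ → ℕ}
    (hq : ∀ j, 1 ≤ q j) (ht : ∀ j, (t j : ℝ) ≤ α * q j) {a p L : ℕ} (hp : 1 ≤ p)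
    (hL : (β - 1) * p ≤ L) :
    (β - α) / (4 * β) * (L + p : ℕ) ≤ 2 * mismatches (multiPatch x C t q) p a L := by
  have hβα : 0 < β - α := sub_pos.2 hαβ
  have hβ : 0 < β := by linarith
  have hC1 : (1 : ℝ) < C := by
    by_contra hcon
    nlinarith
  have hC1' : 1 ≤ C := by exact_mod_cast hC1.le
  have hp' : (1 : ℝ) ≤ p := by exact_mod_cast hp
  have hD0 : (0 : ℝ) < D := by
    by_contra hcon
    nlinarith [sq_nonneg ((N : ℝ) + 2), (Nat.cast_nonneg N : (0 : ℝ) ≤ N)]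
  -- Patch `j` is the last one to start by the final position of the window; only it is taken into
  -- account, and earlier ones are treated as an error.
  obtain ⟨j, hj, hj'⟩ := exists_patchStart_le_lt (t := t) hC1' (a + L + p - 1)
  set w := patch x (patchStart C t j) (t j) (q j) with hw
  have htN : t j ≤ q j * N := by
    have : (t j : ℝ) ≤ (q j * N : ℕ) := by
      push_cast
      refine (ht j).trans ?_
      rw [mul_comm]
      gcongr
    exact_mod_cast this
  obtain ⟨z, hz, hmain⟩ := hx.mismatches_patch (hq j) hp htN a L
  rw [← hw] at hmain
  have hz' : (z : ℝ) ≤ (α - 1) * p := by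
    rcases hz with rfl | ⟨h1, h2⟩
    · have : 0 < α - 1 := sub_pos.2 hα
      simp only [Nat.cast_zero]
      positivity
    · have h1' : (q j : ℝ) ≤ p := by exact_mod_cast h1
      have h2' : (z : ℝ) + p ≤ t j := by exact_mod_cast h2
      have := ht j
      nlinarith
  have hmain' : (D : ℝ) * L ≤ 2 * D * mismatches w p a L + (N + 2) ^ 2 * p + D * z := by
    exact_mod_cast hmain
  -- The choice of `D` brings the block error `(N + 2) ^ 2 * p / D` below `(β - α) / 2 * p`.
  have hpatch : (L : ℝ) ≤ 2 * mismatches w p a L + ((β - α) / 2 + (α - 1)) * p := by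
    refine le_of_mul_le_mul_left ?_ hD0
    nlinarith
  -- The extreme case is `L = (β - 1) * p`, where `L + p = β * p` and the surplus is exactly `(β -
  -- α) / 2 * p`.
  have hpatch' : (β - α) / (2 * β) * (L + p : ℕ) ≤ 2 * mismatches w p a L := by
    rw [div_mul_eq_mul_div, div_le_iff₀ (by positivity)]
    push_cast
    have hnn : 0 ≤ (β + α) * ((L : ℝ) - (β - 1) * p) :=
      mul_nonneg (by linarith) (sub_nonneg.2 hL)
    have := mul_le_mul_of_nonneg_left hpatch (show 0 ≤ 2 * β by positivity)
    nlinarith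
  have hcmp : (mismatches w p a L : ℝ) ≤
      mismatches (multiPatch x C t q) p a L + (β - α) / (8 * β) * (L + p : ℕ) := by
    have hagree : ∀ i, patchPrevEnd C t j ≤ i → i < a + L + p → w i = multiPatch x C t q i :=
      fun i h1 h2 => (multiPatch_eq_patch hC1' x q h1 (by omega)).symm
    rcases le_or_gt (patchPrevEnd C t j) a with hle | hlt
    · have h := mismatches_le_add (E := 0) fun i h1 _ h2 => hagree i (hle.trans h1) h2
      have h' : (mismatches w p a L : ℝ) ≤ mismatches (multiPatch x C t q) p a L := by
        exact_mod_cast h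
      have : 0 ≤ (β - α) / (8 * β) * (L + p : ℕ) := by positivity
      linarith
    -- The window starts before the end `E` of the previous patch and reaches past `C * E`, so `(C -
    -- 1) * E ≤ L + p` and the at most `E` spoiled positions are negligible.
    · have h := mismatches_le_add fun i _ h1 h2 => hagree i h1 h2
      have h' : (mismatches w p a L : ℝ) ≤
          mismatches (multiPatch x C t q) p a L + patchPrevEnd C t j := by
        exact_mod_cast h
      refine h'.trans (add_le_add_right ?_ _)
      have hE := mul_patchPrevEnd_le C t j
      have hE' : (C : ℝ) * patchPrevEnd C t j ≤ patchPrevEnd C t j + (L + p : ℕ) := by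
        have : C * patchPrevEnd C t j ≤ patchPrevEnd C t j + (L + p) := by omega
        exact_mod_cast this
      rw [div_mul_eq_mul_div, le_div_iff₀ (by positivity)]
      have h0 : (0 : ℝ) ≤ patchPrevEnd C t j := Nat.cast_nonneg _
      nlinarith
  have hsplit : (β - α) / (2 * β) * (L + p : ℕ) =
      (β - α) / (4 * β) * (L + p : ℕ) + 2 * ((β - α) / (8 * β) * (L + p : ℕ)) := by
    field_simp
    ring
  linarith

end Patches

/-! ### Choice of constants and conclusion. -/

theorem theorem4 (α β : ℝ) (hα : 1 < α) (hαβ : α < β) :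
    ∃ (m : ℕ) (ω : ℕ → Fin m),
      (∀ r : ℚ, 1 ≤ r → (r : ℝ) < α →
        ∃ i n : ℕ, IsFractionalPower (List.ofFn (substring ω i n)) r) ∧
      ∃ ε : ℝ, 0 < ε ∧
        ∀ (i n : ℕ) (v : Fin n → Fin m) (s : ℚ), β ≤ (s : ℝ) →
          IsFractionalPower (List.ofFn v) s →
          ε * (n : ℝ) ≤ (hammingDist (substring ω i n) v : ℝ) := by
  have hβα : 0 < β - α := sub_pos.2 hαβ
  have hβ : 0 < β := by linarith
  obtain ⟨N, hN⟩ := exists_nat_ge α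
  obtain ⟨D, hD⟩ := exists_nat_ge (2 * ((N : ℝ) + 2) ^ 2 / (β - α))
  rw [div_le_iff₀ hβα] at hD
  obtain ⟨C, hC⟩ := exists_nat_ge (8 * β / (β - α) + 1)
  rw [← le_sub_iff_add_le, div_le_iff₀ hβα] at hC
  have hD1 : 1 ≤ D := by
    refine Nat.one_le_iff_ne_zero.2 fun h => ?_
    rw [h] at hD
    have : (0 : ℝ) < 2 * ((N : ℝ) + 2) ^ 2 := by positivity
    norm_num at hD
    linarith
  have hC1 : 1 ≤ C := by
    refine Nat.one_le_iff_ne_zero.2 fun h => ?_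
    rw [h] at hC
    norm_num at hC
    linarith
  have : NeZero ((16 * D) ^ 2) := ⟨by positivity⟩
  obtain ⟨x, hx⟩ := exists_forall_isSpread (A := ZMod ((16 * D) ^ 2)) hD1 (ZMod.card _)
  have hx' : IsEverywhereSpread D x := fun p L a hp hL => hx (a + L + p) p L a hp hL le_rfl
  have : Nonempty {r : ℚ // 1 ≤ r ∧ (r : ℝ) < α} := ⟨⟨1, le_rfl, by simpa using hα⟩⟩
  obtain ⟨r, hr⟩ := exists_surjective_nat {r : ℚ // 1 ≤ r ∧ (r : ℝ) < α}
  -- Patch `j` realises the `j`-th rational exponent `t j / q j`, in lowest terms.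
  set q : ℕ → ℕ := fun j => (r j).1.den with hqdef
  set t : ℕ → ℕ := fun j => (r j).1.num.toNat with htdef
  have hq : ∀ j, 1 ≤ q j := fun j => (r j).1.den_pos
  have hrt : ∀ j, ((r j : ℚ)) = (t j : ℚ) / q j := by
    intro j
    have h0 : 0 ≤ (r j).1.num := Rat.num_nonneg.2 (zero_le_one.trans (r j).2.1)
    have h1 : ((t j : ℕ) : ℚ) = ((r j).1.num : ℚ) := by
      rw [htdef]
      exact_mod_cast Int.toNat_of_nonneg h0
    rw [h1]
    exact (Rat.num_div_den _).symm
  have hqt : ∀ j, q j ≤ t j := by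
    intro j
    have h1 := (r j).2.1
    have hq0 : (0 : ℚ) < q j := by exact_mod_cast hq j
    rw [hrt j, le_div_iff₀ hq0, one_mul] at h1
    exact_mod_cast h1
  have ht : ∀ j, (t j : ℝ) ≤ α * q j := by
    intro j
    have h1 := (r j).2.2
    have hq0 : (0 : ℝ) < q j := by exact_mod_cast hq j
    rw [hrt j] at h1
    push_cast at h1
    rw [div_lt_iff₀ hq0] at h1
    exact h1.le
  set e := Fintype.equivFin (ZMod ((16 * D) ^ 2) × Fin 3)
  refine ⟨_, e ∘ multiPatch x C t q, fun ρ hρ hρα => ?_, (β - α) / (16 * β), by positivity,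
    fun a n v s hs hv => ?_⟩
  · obtain ⟨j, hj⟩ := hr ⟨ρ, hρ, hρα⟩
    refine ⟨patchStart C t j, t j, ?_⟩
    have h := isFractionalPower_multiPatch e hC1 x q (hq j) (hqt j)
    rwa [← hrt j, hj] at h
  · obtain ⟨p, hp, hn, hper⟩ := hv.exists_period
    have hp' : (1 : ℝ) ≤ p := by exact_mod_cast hp
    have hn' : (n : ℝ) = s * p := by exact_mod_cast hn
    have hβp : β * p ≤ n := by
      rw [hn']
      gcongr
    have hpn : p ≤ n := by
      have : (p : ℝ) ≤ n := by nlinarith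
      exact_mod_cast this
    obtain ⟨L, rfl⟩ := Nat.exists_eq_add_of_le' hpn
    have hL : (β - 1) * p ≤ L := by
      push_cast at hβp
      linarith
    have h1 := hx'.le_mismatches_multiPatch hα hαβ hN hD hC hq ht (a := a) hp hL
    have h2 := mismatches_le_two_mul_hammingDist (e ∘ multiPatch x C t q) (a := a) rfl v hper
    -- One factor `2` from spreadness and one from the Hamming distance turn `(β - α) / (4 * β)`
    -- into `ε = (β - α) / (16 * β)`.
    rw [mismatches_comp e.injective] at h2
    have h2' : (mismatches (multiPatch x C t q) p a L : ℝ) ≤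
        2 * hammingDist (substring (e ∘ multiPatch x C t q) a (L + p)) v := by
      exact_mod_cast h2
    have h3 : (β - α) / (4 * β) * (L + p : ℕ) = 4 * ((β - α) / (16 * β) * (L + p : ℕ)) := by
      field_simp
      ring
    linarith
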